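/- Let $d \ge 0$, $r \ge 0$, $\sigma \ge 0$, and let $\Sigma_0 \in \mathbb{R}^{d\times d}$ be symmetric positive semidefinite with eigenvalues, counted with multiplicity, $\tau_1^2 \ge \cdots \ge \tau_d^2$; put $\tau = (\tau_1,\dots,\tau_d)$. Consider the linear-Gaussian bandit with action set $\mathcal{A} = \{a \in \mathbb{R}^d : \|a\|_2 \le r\}$ and parameter $\theta_* \sim \mathcal{N}(0,\Sigma_0)$. A policy $\pi$ assigns (measurably), for each $t \ge 0$, to every history $H_t = (A_0, R_1, \dots, A_{t-1}, R_t)$ a probability distribution $\pi(H_t)$ on $\mathcal{A}$. At times $t = 0, 1, 2, \dots$, given $(\theta_*, H_t)$, an action $A_t \sim \pi(H_t)$ is drawn, and the reward $$R_{t+1} = \theta_*^\top A_t + W_{t+1}$$ is received, where $W_{t+1} \sim \mathcal{N}(0,\sigma^2)$ is independent of $(\theta_*, H_t, A_t)$. (Degenerate Gaussians are allowed, with $\mathcal{N}(0,0)$ the point mass at $0$.) Let $A_* = a_*(\theta_*)$, where $a_*(\theta) \in \operatorname{argmax}_{a \in \mathcal{A}} \theta^\top a$ for every $\theta \in \mathbb{R}^d$,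 and let the Bayesian regret be $$\mathrm{Regret}^\pi(T) = \sum_{t=0}^{T-1} \mathbb{E}\left[\theta_*^\top A_* - R_{t+1}\right],$$ the expectation being over the prior, the noise and the randomness of the policy. Then for every policy $\pi$ and every $T \in \mathbb{N}$ the random variables $\theta_*^\top A_* - R_{t+1}$, $0 \le t < T$, are integrable and $$\mathrm{Regret}^\pi(T) \ \ge\ \frac{r}{\pi \|\tau\|_2} \sum_{i=2}^{\min\{T,d\}} (i-1)\,\tau_i^2 ,$$ where $\pi$ on the right-hand side is the number $3.14159\ldots$, and the right-hand side is read as $0$ if $\tau = 0$. -/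

import Mathlib

open MeasureTheory ProbabilityTheory
open scoped RealInnerProductSpace NNReal

namespace LinearGaussianBandit

/-- The action set: the closed Euclidean ball of radius `r` around `0` in `ℝ^d`. -/
abbrev Action (d : ℕ) (r : ℝ) : Type :=
  Metric.closedBall (0 : EuclideanSpace ℝ (Fin d)) r

/-- Histories `H_t = (A_0, R_1, …, A_{t-1}, R_t)`; the entry with index `s` is the pair
`(A_s, R_{s+1})`. -/
abbrev History (d : ℕ) (r : ℝ) (t : ℕ) : Type :=
  Fin t → Action d r × ℝ

/-- A (randomized, history-dependent) policy: for each time `t`, a measurable map from histories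
`H_t` to probability distributions over the actions. -/
structure Policy (d : ℕ) (r : ℝ) where
  kernel : (t : ℕ) → Kernel (History d r t) (Action d r)
  markov : ∀ t, IsMarkovKernel (kernel t)

/-- One round of interaction: from `((θ, H_t), A_t)` and the noise `W_{t+1}` to `(θ, H_{t+1})`,
where `H_{t+1}` is `H_t` followed by `(A_t, R_{t+1})`, with reward `R_{t+1} = ⟪θ, A_t⟫ + W_{t+1}`. -/
noncomputable def playRound {d : ℕ} {r : ℝ} (t : ℕ)
    (x : ((EuclideanSpace ℝ (Fin d) × History d r t) × Action d r) × ℝ) :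
    EuclideanSpace ℝ (Fin d) × History d r (t + 1) :=
  (x.1.1.1, Fin.snoc (α := fun _ => Action d r × ℝ) x.1.1.2
    (x.1.2, ⟪x.1.1.1, (x.1.2 : EuclideanSpace ℝ (Fin d))⟫ + x.2))

theorem measurable_playRound {d : ℕ} {r : ℝ} (t : ℕ) : Measurable (playRound (d := d) (r := r) t) := by
  refine Measurable.prodMk (by fun_prop) (measurable_pi_lambda _ fun i => ?_)
  refine Fin.lastCases ?_ (fun j => ?_) i
  · simp only [Fin.snoc_last]
    refine Measurable.prodMk (by fun_prop) (Measurable.add ?_ (by fun_prop))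
    exact Measurable.inner (by fun_prop) (measurable_subtype_coe.comp (by fun_prop))
  · simp only [Fin.snoc_castSucc]
    fun_prop

/-- The joint law of `(θ, H_t)` under the policy `p`, with prior `θ ∼ N(0, S₀)`: given `(θ, H_t)`,
the action `A_t` is drawn from `p` at `H_t`, and the noise `W_{t+1} ∼ N(0, σ²)` is independent of
`(θ, H_t, A_t)`. -/
noncomputable def jointLaw {d : ℕ} {r : ℝ} (S₀ : Matrix (Fin d) (Fin d) ℝ) (σ : ℝ≥0)
    (p : Policy d r) : (t : ℕ) → Measure (EuclideanSpace ℝ (Fin d) × History d r t)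
  | 0 => (multivariateGaussian 0 S₀).map fun θ => (θ, Fin.elim0)
  | t + 1 =>
    ((jointLaw S₀ σ p t ⊗ₘ (p.kernel t).prodMkLeft (EuclideanSpace ℝ (Fin d))).prod
      (gaussianReal 0 (σ ^ 2))).map (playRound t)

instance isProbabilityMeasure_jointLaw {d : ℕ} {r : ℝ} (S₀ : Matrix (Fin d) (Fin d) ℝ) (σ : ℝ≥0)
    (p : Policy d r) (t : ℕ) : IsProbabilityMeasure (jointLaw S₀ σ p t) := by
  induction t with
  | zero =>
    exact Measure.isProbabilityMeasure_map (by fun_prop)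
  | succ t ih =>
    have := p.markov t
    exact Measure.isProbabilityMeasure_map (measurable_playRound t).aemeasurable

/-- `aStar θ` is an optimal action for the parameter `θ`, i.e. a maximizer of `a ↦ ⟪θ, a⟫` over the
action set. -/
def IsOptimalAction {d : ℕ} {r : ℝ} (aStar : EuclideanSpace ℝ (Fin d) → Action d r) : Prop :=
  ∀ θ : EuclideanSpace ℝ (Fin d), ∀ a : Action d r,
    ⟪θ, (a : EuclideanSpace ℝ (Fin d))⟫ ≤ ⟪θ, (aStar θ : EuclideanSpace ℝ (Fin d))⟫

/-- The instantaneous regret `⟪θ, A_*⟫ - R_{t+1}` as a function of `(θ, H_{t+1})`. -/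
noncomputable def instantRegret {d : ℕ} {r : ℝ} (aStar : EuclideanSpace ℝ (Fin d) → Action d r)
    (t : ℕ) (x : EuclideanSpace ℝ (Fin d) × History d r (t + 1)) : ℝ :=
  ⟪x.1, (aStar x.1 : EuclideanSpace ℝ (Fin d))⟫ - (x.2 (Fin.last t)).2

/-- The Bayesian regret `∑_{t=0}^{T-1} E[⟪θ, A_*⟫ - R_{t+1}]` of the policy `p`. -/
noncomputable def bayesRegret {d : ℕ} {r : ℝ} (S₀ : Matrix (Fin d) (Fin d) ℝ) (σ : ℝ≥0)
    (aStar : EuclideanSpace ℝ (Fin d) → Action d r) (p : Policy d r) (T : ℕ) : ℝ :=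
  ∑ t ∈ Finset.range T, ∫ x, instantRegret aStar t x ∂(jointLaw S₀ σ p (t + 1))

end LinearGaussianBandit

open LinearGaussianBandit

/-! Each reward reduces posterior uncertainty in only one direction. Given `H_t` the parameter is
Gaussian, and passing from covariance `C` to the next one after playing `a` changes nothing on
vectors orthogonal to `C a`. Hence after `t` rounds the covariance still equals `S₀` on the
complement of a subspace of dimension at most `t`, whatever the policy. Removing also the direction
of the action about to be played leaves at least `d - t - 1` orthonormal directions, on which Ky
Fan's principle bounds the total variance below by `L`, the sum of the `τ_i²` with `i ≥ t + 2`.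

An action orthogonal to these directions pays for the variance along them: tilting `a` by a vector
of length at most `r c` there increases its norm bound only by the factor `1 + c² / 2`. Choosing the
signs of the tilt by `θ` and using `E|X| ≥ √(2/π) · sd(X)` for Gaussian `X` of any mean gives
expected regret at least `r c √(2/π) √L - r (c²/2) E‖θ‖`. Since `E‖θ‖ ≤ √(tr S₀) = ‖τ‖`, optimizing
over `c` gives `r L / (π ‖τ‖)` for the round. In the sum over `t < T`, the term `τ_i²` with `i ≤ T`
occurs `i - 1` times.

The main steps are `le_regret_of_inner_eq_zero`, `sum_filter_le_sum_inner_of_orthonormal`,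
`IsPosterior.succ` and `ofReal_le_lintegral_regret`. -/

namespace LinearGaussianBandit

/-! ### Geometry of the ball and Ky Fan's principle -/

section LinearAlgebra

/-- The regret of an action `a`, bounded below by the components of `θ` orthogonal to `a`. -/
theorem le_regret_of_inner_eq_zero {E ι : Type*} [NormedAddCommGroup E] [InnerProductSpace ℝ E]
    [Fintype ι] {b : ι → E} (hb : Orthonormal ℝ b) {a : E} (hab : ∀ i, ⟪a, b i⟫ = 0) {r : ℝ}
    (hr : 0 ≤ r) (ha : ‖a‖ ≤ r) {w : ι → ℝ} (hw : ∑ i, w i ^ 2 ≤ 1) (c : ℝ) (θ : E) :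
    r * c * ∑ i, w i * |⟪θ, b i⟫| ≤ (r * ‖θ‖ - ⟪θ, a⟫) + r * (c ^ 2 / 2) * ‖θ‖ := by
  -- The signs follow `θ`, so that `u` collects absolute values; only its orthogonality to `a` and
  -- its norm matter otherwise.
  set s : ι → ℝ := fun i => w i * (if 0 ≤ ⟪θ, b i⟫ then 1 else -1)
  set u : E := ∑ i, s i • b i
  have hs2 : ∀ i, s i ^ 2 = w i ^ 2 := fun i => by
    simp only [s]; split_ifs <;> ring
  have hθu : ⟪θ, u⟫ = ∑ i, w i * |⟪θ, b i⟫| := by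
    simp only [u, inner_sum, real_inner_smul_right, s]
    refine Finset.sum_congr rfl fun i _ => ?_
    split_ifs with h
    · rw [abs_of_nonneg h]; ring
    · rw [abs_of_neg (not_le.1 h)]; ring
  have hau : ⟪a, u⟫ = 0 := by
    simp [u, inner_sum, real_inner_smul_right, hab]
  have huu : ‖u‖ ^ 2 ≤ 1 := by
    rw [← real_inner_self_eq_norm_sq, hb.inner_sum s s Finset.univ]
    simpa [← pow_two, hs2] using hw
  -- By Pythagoras the squared norm is at most `r² (1 + c²) ≤ r² (1 + c²/2)²`. Cauchy–Schwarz
  -- against `θ` then gives the claim.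
  have hnorm : ‖a + (r * c) • u‖ ≤ r * (1 + c ^ 2 / 2) := by
    refine abs_le_of_sq_le_sq' ?_ (by positivity) |>.2
    rw [norm_add_sq_real, real_inner_smul_right, hau, norm_smul, mul_pow, Real.norm_eq_abs,
      sq_abs]
    have h1 : ‖a‖ ^ 2 ≤ r ^ 2 := pow_le_pow_left₀ (norm_nonneg _) ha 2
    have h2 : (r * c) ^ 2 * ‖u‖ ^ 2 ≤ (r * c) ^ 2 := mul_le_of_le_one_right (sq_nonneg _) huu
    nlinarith [sq_nonneg (r * c ^ 2)]
  have h := (real_inner_le_norm θ (a + (r * c) • u)).trans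
    (mul_le_mul_of_nonneg_left hnorm (norm_nonneg θ))
  rw [inner_add_right, real_inner_smul_right, hθu] at h
  linarith

theorem sum_inner_toEuclideanLin_eq {d k : ℕ} {S : Matrix (Fin d) (Fin d) ℝ} (hS : S.IsHermitian)
    (b : Fin k → EuclideanSpace ℝ (Fin d)) :
    ∑ i, ⟪S.toEuclideanLin (b i), b i⟫ =
      ∑ j, hS.eigenvalues j * ∑ i, ⟪hS.eigenvectorBasis j, b i⟫ ^ 2 := by
  have hsym : S.toEuclideanLin.IsSymmetric := Matrix.isSymmetric_toEuclideanLin_iff.2 hS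
  have heig : ∀ j, S.toEuclideanLin (hS.eigenvectorBasis j) =
      hS.eigenvalues j • hS.eigenvectorBasis j := fun j => by
    rw [Matrix.toLpLin_apply, hS.mulVec_eigenvectorBasis]
    rfl
  simp_rw [Finset.mul_sum]
  rw [Finset.sum_comm]
  refine Finset.sum_congr rfl fun i _ => ?_
  rw [← hS.eigenvectorBasis.sum_inner_mul_inner]
  refine Finset.sum_congr rfl fun j _ => ?_
  rw [hsym, heig, real_inner_smul_right, real_inner_comm]
  ring

/-- Ky Fan's minimum principle. -/
theorem sum_filter_le_sum_inner_of_orthonormal {d k m : ℕ} {S : Matrix (Fin d) (Fin d) ℝ}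
    (hS : S.PosSemidef) {τ : Fin d → ℝ} (hτ0 : ∀ j, 0 ≤ τ j) (hτ : Antitone τ)
    (hroots : S.charpoly.roots = Finset.univ.val.map τ)
    {b : Fin k → EuclideanSpace ℝ (Fin d)} (hb : Orthonormal ℝ b) (hk : d ≤ k + m) :
    ∑ j ∈ Finset.univ.filter (fun j : Fin d => m ≤ (j : ℕ)), τ j ≤
      ∑ i, ⟪S.toEuclideanLin (b i), b i⟫ := by
  have hH := hS.isHermitian
  set e := hH.eigenvectorBasis
  rw [sum_inner_toEuclideanLin_eq hH]
  set p : Fin d → ℝ := fun j => ∑ i, ⟪e j, b i⟫ ^ 2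
  have hp0 : ∀ j, 0 ≤ p j := fun j => Finset.sum_nonneg fun i _ => sq_nonneg _
  have hp1 : ∀ j, p j ≤ 1 := fun j => by
    have := hb.sum_inner_products_le (e j) (s := Finset.univ)
    simpa [p, real_inner_comm, e.orthonormal.1 j] using this
  have hpsum : ∑ j, p j = k := by
    simp only [p]
    rw [Finset.sum_comm]
    simp_rw [e.sum_sq_inner_right, hb.1]
    simp
  have hμ0 : ∀ j, 0 ≤ hH.eigenvalues j := hS.eigenvalues_nonneg
  rcases le_or_gt d m with hdm | hmd
  · rw [Finset.filter_false_of_mem (fun j _ => by omega), Finset.sum_empty]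
    exact Finset.sum_nonneg fun j _ => mul_nonneg (hμ0 j) (hp0 j)
  -- The threshold is the largest of the retained values. The weights `p j` lie in `[0, 1]` and sum
  -- to `k`, so each shifted term is at least `min (μ_j - c) 0`. The sum of these minima does not
  -- depend on the order of the eigenvalues, so they may be replaced by `τ`.
  set c := τ ⟨m, hmd⟩
  have hsum : ∑ j, min (hH.eigenvalues j - c) 0 = ∑ j, min (τ j - c) 0 := by
    have h := hH.roots_charpoly_eq_eigenvalues.symm.trans hroots
    have h2 := congrArg (fun s => (s.map fun x => min (x - c) 0).sum) h
    simp only [Multiset.map_map] at h2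
    exact h2
  have hτsum : ∑ j, min (τ j - c) 0 =
      ∑ j ∈ Finset.univ.filter (fun j : Fin d => m ≤ (j : ℕ)), (τ j - c) := by
    rw [Finset.sum_filter]
    refine Finset.sum_congr rfl fun j _ => ?_
    split_ifs with h
    · exact min_eq_left (sub_nonpos.2 (hτ (Fin.mk_le_of_le_val h)))
    · exact min_eq_right (sub_nonneg.2 (hτ (Fin.le_def.2 (not_le.1 h).le)))
  have hcard : (Finset.univ.filter (fun j : Fin d => m ≤ (j : ℕ))).card = d - m := by
    have h1 : Finset.univ.filter (fun j : Fin d => m ≤ (j : ℕ)) = Finset.Ici ⟨m, hmd⟩ := by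
      ext j; simp [Fin.le_def]
    rw [h1, Fin.card_Ici]
  have hterm : ∀ j, min (hH.eigenvalues j - c) 0 ≤ (hH.eigenvalues j - c) * p j := fun j => by
    rcases le_total (hH.eigenvalues j - c) 0 with h | h
    · rw [min_eq_left h]; nlinarith [hp1 j]
    · rw [min_eq_right h]; exact mul_nonneg h (hp0 j)
  have hfin := Finset.sum_le_sum fun j (_ : j ∈ Finset.univ) => hterm j
  rw [hsum, hτsum, Finset.sum_sub_distrib, Finset.sum_const, hcard] at hfin
  simp_rw [sub_mul, Finset.sum_sub_distrib, ← Finset.mul_sum, hpsum] at hfin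
  have hc : c * ((d - m : ℕ) : ℝ) ≤ c * k :=
    mul_le_mul_of_nonneg_left (by exact_mod_cast (by omega)) (hτ0 _)
  rw [nsmul_eq_mul] at hfin
  linarith

/-- The complement of a subspace of dimension at most `m` has an orthonormal basis of at least
`d - m` vectors. -/
theorem exists_orthonormal_orthogonal {d m : ℕ}
    (K : Submodule ℝ (EuclideanSpace ℝ (Fin d))) (hK : Module.finrank ℝ K ≤ m) :
    ∃ (k : ℕ) (b : Fin k → EuclideanSpace ℝ (Fin d)),
      d ≤ k + m ∧ Orthonormal ℝ b ∧ ∀ i, b i ∈ Kᗮ := by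
  refine ⟨Module.finrank ℝ Kᗮ, fun i => (stdOrthonormalBasis ℝ Kᗮ i : Kᗮ), ?_, ?_,
    fun i => Submodule.coe_mem _⟩
  · have := K.finrank_add_finrank_orthogonal
    rw [finrank_euclideanSpace_fin] at this
    omega
  · exact (stdOrthonormalBasis ℝ Kᗮ).orthonormal.comp_linearIsometry Kᗮ.subtypeₗᵢ

end LinearAlgebra

/-! ### Degenerate covariance operators -/

section Covariance

variable {E : Type*} [NormedAddCommGroup E] [InnerProductSpace ℝ E] {C : E →ₗ[ℝ] E}

/-- A direction of zero variance is uncorrelated with everything: otherwise the quadratic form is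
affine and nonconstant along `v - s • a`, hence negative somewhere. The chosen `s` makes it equal to
`-1`. -/
theorem inner_map_eq_zero_of_inner_map_self_eq_zero (hC : C.IsSymmetric)
    (hC0 : ∀ v, 0 ≤ ⟪C v, v⟫) {a : E} (ha : ⟪C a, a⟫ = 0) (v : E) : ⟪C a, v⟫ = 0 := by
  by_contra hne
  set g := ⟪C a, v⟫
  have h := hC0 (v - ((⟪C v, v⟫ + 1) / (2 * g)) • a)
  have hva : ⟪C v, a⟫ = g := by rw [hC, real_inner_comm]
  simp only [map_sub, map_smul, inner_sub_left, inner_sub_right, real_inner_smul_left,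
    real_inner_smul_right, ha, hva] at h
  have h2 : (⟪C v, v⟫ + 1) / (2 * g) * g = (⟪C v, v⟫ + 1) / 2 := by field_simp
  rw [h2] at h
  linarith

/-- The gain satisfies the normal equation, also where the observation is degenerate. -/
theorem inner_gain_mul (hC : C.IsSymmetric) (hC0 : ∀ v, 0 ≤ ⟪C v, v⟫) (σ : ℝ≥0) (a v : E) :
    ⟪(⟪C a, a⟫ + σ)⁻¹ • C a, v⟫ * (⟪C a, a⟫ + σ) = ⟪C a, v⟫ := by
  rw [real_inner_smul_left]
  by_cases hs : ⟪C a, a⟫ + σ = 0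
  · have h0 : ⟪C a, a⟫ = 0 := by
      have := σ.2
      have := hC0 a
      simp only [NNReal.val_eq_coe] at *
      linarith
    rw [hs, mul_zero, inner_map_eq_zero_of_inner_map_self_eq_zero hC hC0 h0]
  · field_simp

end Covariance

/-! ### Absolute moments and Gaussian conditioning -/

section Gaussian

theorem integral_abs_stdGaussian : ∫ x, |x| ∂(gaussianReal 0 1) = √(2 / Real.pi) := by
  rw [integral_gaussianReal_eq_integral_smul one_ne_zero]
  have h1 : ∀ x : ℝ, gaussianPDFReal 0 1 x • |x| =
      (√(2 * Real.pi))⁻¹ * (fun y => y * Real.exp (-(1 / 2) * y ^ 2)) |x| := fun x => by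
    simp only [gaussianPDFReal, smul_eq_mul, NNReal.coe_one, sub_zero, sq_abs, mul_one]
    ring_nf
  simp_rw [h1]
  rw [integral_const_mul,
    integral_comp_abs (f := fun y : ℝ => y * Real.exp (-(1 / 2) * y ^ 2))]
  have h2 : ∫ x in Set.Ioi (0 : ℝ), x * Real.exp (-(1 / 2) * x ^ 2) = 1 := by
    have h := integral_rpow_mul_exp_neg_mul_rpow (p := 2) (q := 1) (b := 1 / 2)
      (by norm_num) (by norm_num) (by norm_num)
    norm_num at h
    norm_num
    exact h
  rw [h2, mul_one, Real.sqrt_div zero_le_two, Real.sqrt_mul zero_le_two]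
  have : √2 * √2 = 2 := Real.mul_self_sqrt zero_le_two
  have h2 : √2 ≠ 0 := by positivity
  have h3 : √Real.pi ≠ 0 := by positivity
  field_simp
  nlinarith

theorem lintegral_abs_stdGaussian :
    ∫⁻ x, ENNReal.ofReal |x| ∂(gaussianReal 0 1) = ENNReal.ofReal (√(2 / Real.pi)) := by
  rw [← integral_abs_stdGaussian, ofReal_integral_eq_lintegral_ofReal]
  · exact (IsGaussian.integrable_id (μ := gaussianReal 0 1)).abs
  · exact Filter.Eventually.of_forall fun x => abs_nonneg x

/-- Symmetrization removes the mean: averaging over `x` and `-x` and using `|μ + s x| + |μ - s x| ≥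
2 |s x|` reduces to the centred case. -/
theorem ofReal_sqrt_le_lintegral_abs_gaussianReal (μ : ℝ) (v : ℝ≥0) :
    ENNReal.ofReal (√v * √(2 / Real.pi)) ≤ ∫⁻ x, ENNReal.ofReal |x| ∂(gaussianReal μ v) := by
  have hmap : gaussianReal μ v = (gaussianReal 0 1).map (fun x => μ + √v * x) := by
    have h := gaussianReal_map_const_mul (μ := 0) (v := 1) (√v)
    have h' : NNReal.mk (√(v : ℝ) ^ 2) (sq_nonneg _) = v := by
      ext; simp
    rw [h', mul_zero, mul_one] at h
    have h2 := gaussianReal_map_const_add (μ := 0) (v := v) μ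
    rw [zero_add, ← h, Measure.map_map (by fun_prop) (by fun_prop)] at h2
    exact h2.symm
  have hneg : (gaussianReal 0 1).map (fun x => -x) = gaussianReal 0 1 := by
    simpa using gaussianReal_map_neg (μ := 0) (v := 1)
  rw [hmap, lintegral_map (by fun_prop) (by fun_prop)]
  set I := ∫⁻ x, ENNReal.ofReal |μ + √v * x| ∂(gaussianReal 0 1)
  have hI : I = ∫⁻ x, ENNReal.ofReal |μ + √v * -x| ∂(gaussianReal 0 1) := by
    simp only [I]
    conv_lhs => rw [← hneg]
    rw [lintegral_map (by fun_prop) (by fun_prop)]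
  have h2 : 2 * ENNReal.ofReal (√v * √(2 / Real.pi)) ≤ 2 * I := by
    rw [two_mul I]
    nth_rewrite 2 [hI]
    rw [← lintegral_add_left (by fun_prop), ENNReal.ofReal_mul (by positivity),
      ← lintegral_abs_stdGaussian, ← mul_assoc, ← lintegral_const_mul _ (by fun_prop)]
    refine lintegral_mono fun x => ?_
    rw [← ENNReal.ofReal_add (abs_nonneg _) (abs_nonneg _), mul_assoc,
      ← ENNReal.ofReal_mul (by positivity), ← ENNReal.ofReal_ofNat, ← ENNReal.ofReal_mul two_pos.le]
    refine ENNReal.ofReal_le_ofReal ?_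
    have h := abs_sub (μ + √v * x) (μ + √v * -x)
    have h' : μ + √v * x - (μ + √v * -x) = 2 * (√v * x) := by ring
    rw [h', abs_mul, abs_mul, abs_two, abs_of_nonneg (Real.sqrt_nonneg _)] at h
    exact h
  exact (ENNReal.mul_le_mul_iff_right two_ne_zero ENNReal.ofNat_ne_top).1 h2

variable {E : Type*} [NormedAddCommGroup E] [InnerProductSpace ℝ E] [MeasurableSpace E]

/-- `κ` is the Gaussian distribution with mean `m` and covariance operator `C`. -/
def IsGaussianWith (κ : Measure E) (m : E) (C : E →ₗ[ℝ] E) : Prop :=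
  ∀ v, charFun κ v = Complex.exp (⟪m, v⟫ * Complex.I - ⟪C v, v⟫ / 2)

variable {κ : Measure E} {m : E} {C : E →ₗ[ℝ] E}

/-- The joint characteristic function of parameter and noise. In this section `σ` is the noise
variance; it is later instantiated with `σ ^ 2`. -/
theorem IsGaussianWith.integral_exp [SFinite κ] (h : IsGaussianWith κ m C) (σ : ℝ≥0) (v : E)
    (c : ℝ) :
    ∫ z, Complex.exp (((⟪z.1, v⟫ + c * z.2 : ℝ) : ℂ) * Complex.I) ∂(κ.prod (gaussianReal 0 σ)) =
      Complex.exp (⟪m, v⟫ * Complex.I - ((⟪C v, v⟫ + c ^ 2 * σ : ℝ) : ℂ) / 2) := by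
  have h1 : ∀ z : E × ℝ, Complex.exp (((⟪z.1, v⟫ + c * z.2 : ℝ) : ℂ) * Complex.I) =
      Complex.exp (⟪z.1, v⟫ * Complex.I) * Complex.exp (c * z.2 * Complex.I) := fun z => by
    rw [← Complex.exp_add]; push_cast; ring_nf
  simp_rw [h1]
  rw [integral_prod_mul (fun x : E => Complex.exp (⟪x, v⟫ * Complex.I))
    (fun y : ℝ => Complex.exp (c * y * Complex.I)), ← charFun_apply, ← charFun_apply_real, h v,
    charFun_gaussianReal, ← Complex.exp_add]
  push_cast
  ring_nf

variable [BorelSpace E]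

theorem IsGaussianWith.map_inner (h : IsGaussianWith κ m C) [IsFiniteMeasure κ]
    [SecondCountableTopology E] (b : E) (hb : 0 ≤ ⟪C b, b⟫) :
    κ.map (fun x => ⟪x, b⟫) = gaussianReal ⟪m, b⟫ ⟪C b, b⟫.toNNReal := by
  refine Measure.ext_of_charFun (funext fun s => ?_)
  rw [charFun_gaussianReal, charFun_apply_real, integral_map (by fun_prop) (by fun_prop)]
  have h' := h (s • b)
  rw [charFun_apply] at h'
  simp_rw [map_smul, real_inner_smul_left, real_inner_smul_right] at h'
  convert h' using 2
  · simp
  · rw [Real.coe_toNNReal _ hb]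
    push_cast
    ring_nf

/-- Given `θ ∼ N(m, C)` and `R = ⟪θ, a⟫ + w` with noise `w ∼ N(0, σ)`, the posterior of `θ` is
the law of `θ' + (R - (⟪θ', a⟫ + w')) • k` with a fresh copy `(θ', w')` and the gain `k`. -/
theorem IsGaussianWith.map_observation [CompleteSpace E] [SecondCountableTopology E]
    [IsProbabilityMeasure κ] (h : IsGaussianWith κ m C) (hC : C.IsSymmetric)
    (hC0 : ∀ v, 0 ≤ ⟪C v, v⟫) (σ : ℝ≥0) (a : E) :
    (κ.prod (gaussianReal 0 σ)).map (fun x => (x.1, ⟪x.1, a⟫ + x.2)) =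
      ((κ.prod (gaussianReal 0 σ)).prod (κ.prod (gaussianReal 0 σ))).map
        (fun y => (y.2.1 + (⟪y.1.1, a⟫ + y.1.2 - (⟪y.2.1, a⟫ + y.2.2)) •
          ((⟪C a, a⟫ + σ)⁻¹ • C a), ⟪y.1.1, a⟫ + y.1.2)) := by
  set k : E := (⟪C a, a⟫ + σ)⁻¹ • C a
  have : IsFiniteMeasure ((κ.prod (gaussianReal 0 σ)).map
    (fun x : E × ℝ => (x.1, ⟪x.1, a⟫ + x.2))) := Measure.isFiniteMeasure_map _ _
  refine Measure.ext_of_charFunDual (funext fun L => ?_)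
  obtain ⟨v, c, hL⟩ : ∃ v : E, ∃ c : ℝ, ∀ z : E × ℝ, L z = ⟪z.1, v⟫ + c * z.2 := by
    refine ⟨(InnerProductSpace.toDual ℝ E).symm (L.comp (.inl ℝ E ℝ)), L (0, 1), fun z => ?_⟩
    rw [real_inner_comm, InnerProductSpace.toDual_symm_apply]
    have hz : z = (z.1, 0) + z.2 • ((0, 1) : E × ℝ) := by ext <;> simp
    conv_lhs => rw [hz]
    rw [map_add, map_smul, smul_eq_mul, mul_comm]
    rfl
  rw [charFunDual_apply, charFunDual_apply, integral_map (by fun_prop) (by fun_prop),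
    integral_map (by fun_prop) (by fun_prop)]
  simp_rw [hL]
  set q : ℝ := ⟪k, v⟫
  have hq : q * (⟪C a, a⟫ + σ) = ⟪C a, v⟫ := inner_gain_mul hC hC0 σ a v
  have h1 : ∀ x : E × ℝ, ⟪x.1, v⟫ + c * (⟪x.1, a⟫ + x.2) = ⟪x.1, v + c • a⟫ + c * x.2 :=
    fun x => by rw [inner_add_right, real_inner_smul_right]; ring
  -- The exponent separates the original pair `y.1` from the fresh pair `y.2`, so the integral over
  -- the product factors.
  have h2 : ∀ y : (E × ℝ) × (E × ℝ),
      Complex.exp (((⟪y.2.1 + (⟪y.1.1, a⟫ + y.1.2 - (⟪y.2.1, a⟫ + y.2.2)) • k, v⟫ +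
        c * (⟪y.1.1, a⟫ + y.1.2) : ℝ) : ℂ) * Complex.I) =
      Complex.exp (((⟪y.1.1, (q + c) • a⟫ + (q + c) * y.1.2 : ℝ) : ℂ) * Complex.I) *
      Complex.exp (((⟪y.2.1, v - q • a⟫ + (-q) * y.2.2 : ℝ) : ℂ) * Complex.I) := fun y => by
    rw [← Complex.exp_add, ← add_mul, ← Complex.ofReal_add]
    congr 3
    simp only [inner_add_left, inner_sub_right, real_inner_smul_left, real_inner_smul_right]
    ring
  simp_rw [h1, h2]
  rw [integral_prod_mul
    (fun z : E × ℝ => Complex.exp (((⟪z.1, (q + c) • a⟫ + (q + c) * z.2 : ℝ) : ℂ) * Complex.I))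
    (fun z : E × ℝ => Complex.exp (((⟪z.1, v - q • a⟫ + (-q) * z.2 : ℝ) : ℂ) * Complex.I)),
    h.integral_exp, h.integral_exp, h.integral_exp, ← Complex.exp_add]
  have hva : ⟪C v, a⟫ = ⟪C a, v⟫ := by rw [hC, real_inner_comm]
  have hmean : ⟪m, v + c • a⟫ = ⟪m, (q + c) • a⟫ + ⟪m, v - q • a⟫ := by
    simp only [inner_add_right, inner_sub_right, real_inner_smul_right]; ring
  -- The cross terms agree exactly by the normal equation `hq`: the residual is uncorrelated with
  -- the observation.
  have hcov : ⟪C (v + c • a), v + c • a⟫ + c ^ 2 * σ =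
      (⟪C ((q + c) • a), (q + c) • a⟫ + (q + c) ^ 2 * σ) +
      (⟪C (v - q • a), v - q • a⟫ + (-q) ^ 2 * σ) := by
    simp only [map_add, map_sub, map_smul, inner_add_left, inner_add_right, inner_sub_left,
      inner_sub_right, real_inner_smul_left, real_inner_smul_right, hva, ← hq]
    ring
  rw [hmean, hcov]
  push_cast
  ring_nf

/-- The law of `θ + (R - (⟪θ, a⟫ + w)) • k`, with `k` the gain, is Gaussian. -/
theorem IsGaussianWith.map_update [SecondCountableTopology E]
    [IsProbabilityMeasure κ] (h : IsGaussianWith κ m C) (hC : C.IsSymmetric)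
    (hC0 : ∀ v, 0 ≤ ⟪C v, v⟫) (σ : ℝ≥0) (a : E) (R : ℝ) {C' : E →ₗ[ℝ] E}
    (hC' : ∀ v, C' v = C v - ⟪(⟪C a, a⟫ + σ)⁻¹ • C a, v⟫ • C a) :
    IsGaussianWith ((κ.prod (gaussianReal 0 σ)).map
        (fun x => x.1 + (R - (⟪x.1, a⟫ + x.2)) • ((⟪C a, a⟫ + σ)⁻¹ • C a)))
      (m + (R - ⟪m, a⟫) • ((⟪C a, a⟫ + σ)⁻¹ • C a)) C' := by
  intro v
  set k : E := (⟪C a, a⟫ + σ)⁻¹ • C a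
  set q : ℝ := ⟪k, v⟫
  have hq : q * (⟪C a, a⟫ + σ) = ⟪C a, v⟫ := inner_gain_mul hC hC0 σ a v
  have hva : ⟪C v, a⟫ = ⟪C a, v⟫ := by rw [hC, real_inner_comm]
  rw [charFun_apply, integral_map (by fun_prop) (by fun_prop)]
  have h2 : ∀ y : E × ℝ,
      Complex.exp ((⟪y.1 + (R - (⟪y.1, a⟫ + y.2)) • k, v⟫ : ℂ) * Complex.I) =
      Complex.exp ((R * q : ℝ) * Complex.I) *
      Complex.exp (((⟪y.1, v - q • a⟫ + (-q) * y.2 : ℝ) : ℂ) * Complex.I) := fun y => by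
    rw [← Complex.exp_add, ← add_mul, ← Complex.ofReal_add]
    congr 3
    simp only [inner_add_left, inner_sub_right, real_inner_smul_left, real_inner_smul_right]
    ring
  simp_rw [h2]
  rw [integral_const_mul, h.integral_exp, ← Complex.exp_add]
  have hmean : ⟪m + (R - ⟪m, a⟫) • k, v⟫ = R * q + ⟪m, v - q • a⟫ := by
    simp only [inner_add_left, inner_sub_right, real_inner_smul_left, real_inner_smul_right]
    ring
  have hcov : ⟪C' v, v⟫ = ⟪C (v - q • a), v - q • a⟫ + (-q) ^ 2 * σ := by
    simp only [hC', map_sub, map_smul, inner_sub_left,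
      inner_sub_right, real_inner_smul_left, real_inner_smul_right, hva, ← hq]
    ring
  rw [hmean, hcov]
  push_cast
  ring_nf

end Gaussian

/-! ### The posterior given the history -/

section Posterior

open scoped ENNReal

variable {d : ℕ} {r : ℝ}

/-- The observation gain for the action `a` when the covariance operator is `C`. -/
noncomputable def gain {E : Type*} [NormedAddCommGroup E] [InnerProductSpace ℝ E]
    (C : E →ₗ[ℝ] E) (σ : ℝ≥0) (a : E) : E :=
  (⟪C a, a⟫ + (σ ^ 2 : ℝ≥0))⁻¹ • C a

/-- The covariance operator after observing the reward of the action `a`. -/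
noncomputable def updateCov {E : Type*} [NormedAddCommGroup E] [InnerProductSpace ℝ E]
    (C : E →ₗ[ℝ] E) (σ : ℝ≥0) (a : E) : E →ₗ[ℝ] E :=
  C - (innerₗ E (gain C σ a)).smulRight (C a)

theorem updateCov_apply {E : Type*} [NormedAddCommGroup E] [InnerProductSpace ℝ E]
    (C : E →ₗ[ℝ] E) (σ : ℝ≥0) (a v : E) :
    updateCov C σ a v = C v - ⟪gain C σ a, v⟫ • C a := by
  simp [updateCov]

theorem isSymmetric_updateCov {E : Type*} [NormedAddCommGroup E] [InnerProductSpace ℝ E]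
    {C : E →ₗ[ℝ] E} (hC : C.IsSymmetric) (σ : ℝ≥0) (a : E) : (updateCov C σ a).IsSymmetric := by
  intro v w
  simp only [updateCov_apply, inner_sub_left, inner_sub_right, real_inner_smul_left,
    real_inner_smul_right, gain, hC v w, real_inner_comm (C a) v]
  ring

/-- With `q = ⟪gain C σ a, v⟫`, the new form at `v` is the old form at `v - q • a` plus `q² σ²`. -/
theorem inner_updateCov_nonneg {E : Type*} [NormedAddCommGroup E] [InnerProductSpace ℝ E]
    {C : E →ₗ[ℝ] E} (hC : C.IsSymmetric) (hC0 : ∀ v, 0 ≤ ⟪C v, v⟫) (σ : ℝ≥0) (a v : E) :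
    0 ≤ ⟪updateCov C σ a v, v⟫ := by
  have hq := inner_gain_mul hC hC0 (σ ^ 2) a v
  have hva : ⟪C v, a⟫ = ⟪C a, v⟫ := by rw [hC, real_inner_comm]
  have h := hC0 (v - ⟪gain C σ a, v⟫ • a)
  have hσ : 0 ≤ ⟪gain C σ a, v⟫ ^ 2 * (σ ^ 2 : ℝ≥0) := by positivity
  simp only [updateCov_apply, map_sub, map_smul, inner_sub_left, inner_sub_right,
    real_inner_smul_left, real_inner_smul_right, hva] at h ⊢
  change ⟪gain C σ a, v⟫ * _ = _ at hq
  rw [← hq] at h ⊢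
  nlinarith

/-- `κ` is a version of the posterior law of `θ` given `H_t`; it is Gaussian with means `m` and
covariance operators `C`, which agree with the prior covariance off a subspace of dimension at
most `t`. -/
structure IsPosterior (S₀ : Matrix (Fin d) (Fin d) ℝ) (σ : ℝ≥0) (p : Policy d r) (t : ℕ)
    (κ : Kernel (History d r t) (EuclideanSpace ℝ (Fin d)))
    (m : History d r t → EuclideanSpace ℝ (Fin d))
    (C : History d r t → EuclideanSpace ℝ (Fin d) →ₗ[ℝ] EuclideanSpace ℝ (Fin d)) : Prop where
  measurable : Measurable fun x : History d r t × EuclideanSpace ℝ (Fin d) => C x.1 x.2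
  isSymmetric : ∀ h, (C h).IsSymmetric
  nonneg : ∀ h v, 0 ≤ ⟪C h v, v⟫
  isGaussian : ∀ h, IsGaussianWith (κ h) (m h) (C h)
  exists_subspace : ∀ h, ∃ K : Submodule ℝ (EuclideanSpace ℝ (Fin d)),
    Module.finrank ℝ K ≤ t ∧ ∀ v ∈ Kᗮ, C h v = S₀.toEuclideanLin v
  -- Conditioning is expressed by invariance: redrawing the parameter from `κ` at the observed
  -- history preserves the joint law.
  resample : ∀ F : EuclideanSpace ℝ (Fin d) × History d r t → ℝ≥0∞, Measurable F →
    ∫⁻ x, F x ∂(jointLaw S₀ σ p t) = ∫⁻ x, ∫⁻ θ, F (θ, x.2) ∂(κ x.2) ∂(jointLaw S₀ σ p t)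

theorem lintegral_jointLaw_succ (S₀ : Matrix (Fin d) (Fin d) ℝ) (σ : ℝ≥0) (p : Policy d r) (t : ℕ)
    {F : EuclideanSpace ℝ (Fin d) × History d r (t + 1) → ℝ≥0∞} (hF : Measurable F) :
    ∫⁻ x, F x ∂(jointLaw S₀ σ p (t + 1)) =
      ∫⁻ x, ∫⁻ a, ∫⁻ w, F (playRound t ((x, a), w)) ∂(gaussianReal 0 (σ ^ 2))
        ∂(p.kernel t x.2) ∂(jointLaw S₀ σ p t) := by
  have := p.markov t
  have hm : Measurable fun y => F (playRound t y) := hF.comp (measurable_playRound t)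
  rw [jointLaw, lintegral_map hF (measurable_playRound t), lintegral_prod _ hm.aemeasurable,
    Measure.lintegral_compProd hm.lintegral_prod_right']
  simp only [Kernel.prodMkLeft_apply]

variable {S₀ : Matrix (Fin d) (Fin d) ℝ} {σ : ℝ≥0} {p : Policy d r} {t : ℕ}
    {κ : Kernel (History d r t) (EuclideanSpace ℝ (Fin d))}
    {m : History d r t → EuclideanSpace ℝ (Fin d)}
    {C : History d r t → EuclideanSpace ℝ (Fin d) →ₗ[ℝ] EuclideanSpace ℝ (Fin d)}

/-- The history `h` followed by the action `a` and the reward `R`. -/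
def snocHistory (h : History d r t) (a : Action d r) (R : ℝ) : History d r (t + 1) :=
  Fin.snoc (α := fun _ => Action d r × ℝ) h (a, R)

theorem measurable_snocHistory (h : History d r t) (a : Action d r) :
    Measurable fun R => snocHistory h a R := by
  refine measurable_pi_lambda _ fun i => ?_
  refine Fin.lastCases ?_ (fun j => ?_) i
  · simp only [snocHistory, Fin.snoc_last]
    fun_prop
  · simp only [snocHistory, Fin.snoc_castSucc]
    fun_prop

/-- The policy sees only the history, so given `H_t` the action is independent of the parameter.
After resampling, Tonelli lets the action be fixed before the parameter and noise are drawn. -/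
theorem IsPosterior.lintegral_succ [IsMarkovKernel κ] (hκ : IsPosterior S₀ σ p t κ m C)
    {F : EuclideanSpace ℝ (Fin d) × History d r (t + 1) → ℝ≥0∞} (hF : Measurable F) :
    ∫⁻ x, F x ∂(jointLaw S₀ σ p (t + 1)) =
      ∫⁻ x, ∫⁻ a, ∫⁻ z, F (z.1, snocHistory x.2 a (⟪z.1, (a : EuclideanSpace ℝ (Fin d))⟫ + z.2))
        ∂((κ x.2).prod (gaussianReal 0 (σ ^ 2))) ∂(p.kernel t x.2) ∂(jointLaw S₀ σ p t) := by
  have := p.markov t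
  have hm : Measurable fun y => F (playRound t y) := hF.comp (measurable_playRound t)
  have hm2 := hm.lintegral_prod_right' (ν := gaussianReal 0 (σ ^ 2))
  rw [lintegral_jointLaw_succ S₀ σ p t hF, hκ.resample]
  · refine lintegral_congr fun x => ?_
    refine (lintegral_lintegral_swap (μ := κ x.2) (ν := p.kernel t x.2) ?_).trans ?_
    rotate_left
    · refine lintegral_congr fun a => ?_
      rw [lintegral_prod]
      · rfl
      · have : Measurable fun z : EuclideanSpace ℝ (Fin d) × ℝ => (((z.1, x.2), a), z.2) := by
          fun_prop
        exact (hm.comp this).aemeasurable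
    · have : Measurable fun z : EuclideanSpace ℝ (Fin d) × Action d r => ((z.1, x.2), z.2) := by
        fun_prop
      exact (hm2.comp this).aemeasurable
  · exact hm2.lintegral_kernel_prod_right'
      (κ := (p.kernel t).prodMkLeft (EuclideanSpace ℝ (Fin d)))

theorem isPosterior_zero (hS₀ : S₀.PosSemidef) :
    IsPosterior S₀ σ p 0 (Kernel.const _ (multivariateGaussian 0 S₀)) (fun _ => 0)
      (fun _ => S₀.toEuclideanLin) where
  measurable := by
    have : Continuous S₀.toEuclideanLin := LinearMap.continuous_of_finiteDimensional _
    exact this.measurable.comp measurable_snd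
  isSymmetric _ := Matrix.isSymmetric_toEuclideanLin_iff.2 hS₀.isHermitian
  nonneg _ v := by
    have := (Matrix.isPositive_toEuclideanLin_iff.2 hS₀).re_inner_nonneg_left v
    simpa using this
  isGaussian _ v := by
    rw [Kernel.const_apply, charFun_multivariateGaussian hS₀, inner_zero_left, inner_zero_right,
      Matrix.toLpLin_apply, EuclideanSpace.inner_eq_star_dotProduct]
    simp
  exists_subspace _ := ⟨⊥, by simp, fun _ _ => rfl⟩
  resample F hF := by
    have hm : Measurable fun θ : EuclideanSpace ℝ (Fin d) =>
      ((θ, Fin.elim0) : EuclideanSpace ℝ (Fin d) × History d r 0) := by fun_prop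
    simp only [Kernel.const_apply]
    rw [jointLaw, lintegral_map hF hm]
    have : ∀ x : EuclideanSpace ℝ (Fin d) × History d r 0,
        ∫⁻ θ, F (θ, x.2) ∂(multivariateGaussian 0 S₀) =
        ∫⁻ θ, F (θ, Fin.elim0) ∂(multivariateGaussian 0 S₀) := fun x => by
      rw [Subsingleton.elim x.2 Fin.elim0]
    simp_rw [this]
    have := Measure.isProbabilityMeasure_map (μ := multivariateGaussian 0 S₀) hm.aemeasurable
    rw [lintegral_const, measure_univ, mul_one]

/-- The new kernel draws a fresh parameter and noise, and corrects the parameter by the gain times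
the discrepancy from the observed reward. With history and action fixed, its correctness is
`IsGaussianWith.map_observation`. -/
theorem IsPosterior.succ [IsMarkovKernel κ] (hκ : IsPosterior S₀ σ p t κ m C) :
    ∃ κ' m' C', IsMarkovKernel κ' ∧ IsPosterior S₀ σ p (t + 1) κ' m' C' := by
  have := p.markov t
  set init : History d r (t + 1) → History d r t := fun h i => h i.castSucc
  have hinit : Measurable init := by fun_prop
  set act : History d r (t + 1) → EuclideanSpace ℝ (Fin d) := fun h => (h (Fin.last t)).1
  have hact : Measurable act := by fun_prop
  set k : History d r (t + 1) → EuclideanSpace ℝ (Fin d) := fun h => gain (C (init h)) σ (act h)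
  have hCa : Measurable fun h => C (init h) (act h) :=
    hκ.measurable.comp (hinit.prodMk hact)
  have hs : Measurable fun h => ⟪C (init h) (act h), act h⟫ := hCa.inner hact
  have hk : Measurable k := (hs.add_const _).inv.smul hCa
  set f : History d r (t + 1) × (EuclideanSpace ℝ (Fin d) × ℝ) → EuclideanSpace ℝ (Fin d) :=
    fun y => y.2.1 + ((y.1 (Fin.last t)).2 - (⟪y.2.1, act y.1⟫ + y.2.2)) • k y.1
  have hf : Measurable f := by fun_prop
  set κ' : Kernel (History d r (t + 1)) (EuclideanSpace ℝ (Fin d)) :=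
    (Kernel.id ×ₖ (κ.comap init hinit ×ₖ Kernel.const _ (gaussianReal 0 (σ ^ 2)))).map f
  have hκ' : ∀ h, κ' h =
      ((κ (init h)).prod (gaussianReal 0 (σ ^ 2))).map fun z => f (h, z) := fun h => by
    simp only [κ']
    rw [Kernel.map_apply _ hf, Kernel.prod_apply, Kernel.prod_apply, Kernel.id_apply,
      Measure.dirac_prod, Measure.map_map hf (by fun_prop)]
    rfl
  refine ⟨κ', fun h => m (init h) + ((h (Fin.last t)).2 - ⟪m (init h), act h⟫) • k h,
    fun h => updateCov (C (init h)) σ (act h), Kernel.IsMarkovKernel.map _ hf,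
    ?_, fun h => isSymmetric_updateCov (hκ.isSymmetric _) _ _,
    fun h v => inner_updateCov_nonneg (hκ.isSymmetric _) (hκ.nonneg _) _ _ _, fun h => ?_,
    fun h => ?_, fun F hF => ?_⟩
  · simp only [updateCov_apply]
    have h1 : Measurable fun x : History d r (t + 1) × EuclideanSpace ℝ (Fin d) =>
        C (init x.1) x.2 := hκ.measurable.comp ((hinit.comp measurable_fst).prodMk measurable_snd)
    have h2 : Measurable fun x : History d r (t + 1) × EuclideanSpace ℝ (Fin d) =>
        ⟪k x.1, x.2⟫ := (hk.comp measurable_fst).inner measurable_snd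
    exact h1.sub (h2.smul (hCa.comp measurable_fst))
  · rw [hκ']
    exact (hκ.isGaussian (init h)).map_update (hκ.isSymmetric _) (hκ.nonneg _) (σ ^ 2) (act h)
      (h (Fin.last t)).2 fun v => updateCov_apply _ _ _ _
  · obtain ⟨K, hK, hKC⟩ := hκ.exists_subspace (init h)
    -- The direction added is `C a`, not `a`: the gain is a multiple of `C a`, so the correction
    -- vanishes on its complement.
    refine ⟨K ⊔ Submodule.span ℝ {C (init h) (act h)}, ?_, fun v hv => ?_⟩
    · exact (Submodule.finrank_add_le_finrank_add_finrank _ _).trans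
        (add_le_add hK ((finrank_span_le_card _).trans (by simp)))
    · rw [← Submodule.inf_orthogonal, Submodule.mem_inf, Submodule.mem_orthogonal_singleton_iff_inner_right] at hv
      rw [updateCov_apply, hKC v hv.1, gain, real_inner_smul_left, hv.2, mul_zero, zero_smul,
        sub_zero]
  · set G : History d r (t + 1) → ℝ≥0∞ := fun h => ∫⁻ θ, F (θ, h) ∂(κ' h)
    have hκ'm : IsMarkovKernel κ' := Kernel.IsMarkovKernel.map _ hf
    have hG : Measurable G := (hF.comp measurable_swap).lintegral_kernel_prod_right'
    rw [hκ.lintegral_succ hF]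
    change _ = ∫⁻ x, (G ∘ Prod.snd) x ∂_
    rw [hκ.lintegral_succ (hG.comp measurable_snd)]
    refine lintegral_congr fun x => lintegral_congr fun a => ?_
    have hsnoc : Measurable fun R : ℝ => snocHistory x.2 a R :=
      measurable_snocHistory x.2 a
    have hFs : Measurable fun y : EuclideanSpace ℝ (Fin d) × ℝ =>
        F (y.1, snocHistory x.2 a y.2) := by fun_prop
    have hstep := (hκ.isGaussian x.2).map_observation (hκ.isSymmetric _) (hκ.nonneg _) (σ ^ 2)
      (a : EuclideanSpace ℝ (Fin d))
    calc _ = ∫⁻ y, F (y.1, snocHistory x.2 a y.2) ∂(((κ x.2).prod (gaussianReal 0 (σ ^ 2))).map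
          (fun z => (z.1, ⟪z.1, (a : EuclideanSpace ℝ (Fin d))⟫ + z.2))) := by
          rw [lintegral_map hFs (by fun_prop)]
      _ = _ := by
          rw [hstep, lintegral_map hFs (by fun_prop), lintegral_prod _ (by fun_prop)]
          refine lintegral_congr fun z => ?_
          simp only [G, Function.comp_apply]
          rw [hκ', lintegral_map (by fun_prop) (by fun_prop)]
          simp [f, init, act, k, snocHistory, gain]

theorem exists_isPosterior (hS₀ : S₀.PosSemidef) (σ : ℝ≥0) (p : Policy d r) (t : ℕ) :
    ∃ κ m C, IsMarkovKernel κ ∧ IsPosterior S₀ σ p t κ m C := by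
  induction t with
  | zero => exact ⟨_, _, _, inferInstance, isPosterior_zero hS₀⟩
  | succ t ih =>
    obtain ⟨κ, m, C, _, h⟩ := ih
    exact h.succ

end Posterior

/-! ### Regret per round and summation -/

section Regret

open scoped ENNReal

variable {d : ℕ} {r : ℝ}

theorem IsOptimalAction.inner_eq {aStar : EuclideanSpace ℝ (Fin d) → Action d r}
    (h : IsOptimalAction aStar) (hr : 0 ≤ r) (θ : EuclideanSpace ℝ (Fin d)) :
    ⟪θ, (aStar θ : EuclideanSpace ℝ (Fin d))⟫ = r * ‖θ‖ := by
  refine le_antisymm ?_ ?_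
  · rw [mul_comm]
    exact (real_inner_le_norm _ _).trans (mul_le_mul_of_nonneg_left
      (mem_closedBall_zero_iff.1 (aStar θ).2) (norm_nonneg _))
  · rcases eq_or_ne θ 0 with rfl | hθ
    · simp
    have hθ' : ‖θ‖ ≠ 0 := norm_ne_zero_iff.2 hθ
    have hmem : (r * ‖θ‖⁻¹) • θ ∈ Metric.closedBall (0 : EuclideanSpace ℝ (Fin d)) r := by
      rw [mem_closedBall_zero_iff, norm_smul, Real.norm_of_nonneg (by positivity), mul_assoc,
        inv_mul_cancel₀ hθ', mul_one]
    have h1 := h θ ⟨_, hmem⟩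
    rw [real_inner_smul_right, real_inner_self_eq_norm_sq] at h1
    refine le_of_eq_of_le ?_ h1
    field_simp

/-- A lower bound for the posterior expected regret of an action, up to a multiple of the
expected norm. -/
theorem ofReal_le_lintegral_regret {S₀ : Matrix (Fin d) (Fin d) ℝ} (hS₀ : S₀.PosSemidef)
    {τ : Fin d → ℝ} (hτ0 : ∀ j, 0 ≤ τ j) (hτ : Antitone τ)
    (hroots : S₀.charpoly.roots = Finset.univ.val.map τ)
    {κ : Measure (EuclideanSpace ℝ (Fin d))} [IsProbabilityMeasure κ]
    {m : EuclideanSpace ℝ (Fin d)} {C : EuclideanSpace ℝ (Fin d) →ₗ[ℝ] EuclideanSpace ℝ (Fin d)}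
    (h : IsGaussianWith κ m C) (hC0 : ∀ v, 0 ≤ ⟪C v, v⟫) {t : ℕ}
    {K : Submodule ℝ (EuclideanSpace ℝ (Fin d))} (hK : Module.finrank ℝ K ≤ t)
    (hKC : ∀ v ∈ Kᗮ, C v = S₀.toEuclideanLin v) (hr : 0 ≤ r) (a : Action d r) {c : ℝ}
    (hc : 0 ≤ c) :
    ENNReal.ofReal (r * c * √(2 / Real.pi) *
        √(∑ j ∈ Finset.univ.filter (fun j : Fin d => t + 1 ≤ (j : ℕ)), τ j)) ≤
      ∫⁻ θ, ENNReal.ofReal ((r * ‖θ‖ - ⟪θ, (a : EuclideanSpace ℝ (Fin d))⟫) +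
        r * (c ^ 2 / 2) * ‖θ‖) ∂κ := by
  obtain ⟨k, b, hk, hb, hbK⟩ := exists_orthonormal_orthogonal (m := t + 1)
    (K ⊔ Submodule.span ℝ {(a : EuclideanSpace ℝ (Fin d))})
    ((Submodule.finrank_add_le_finrank_add_finrank _ _).trans
        (add_le_add hK ((finrank_span_le_card _).trans (by simp))))
  simp only [← Submodule.inf_orthogonal, Submodule.mem_inf,
    Submodule.mem_orthogonal_singleton_iff_inner_right] at hbK
  have hky := sum_filter_le_sum_inner_of_orthonormal hS₀ hτ0 hτ hroots hb hk
  simp_rw [← fun i => hKC _ (hbK i).1] at hky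
  set v : Fin k → ℝ := fun i => ⟪C (b i), b i⟫
  have hv0 : ∀ i, 0 ≤ v i := fun i => hC0 _
  set V := ∑ i, v i
  have hV0 : 0 ≤ V := Finset.sum_nonneg fun i _ => hv0 i
  -- These weights give equality in Cauchy–Schwarz, turning `∑ w_i √(v_i)` into `√V`. If `V = 0`
  -- they all vanish, which is why `hw` is only an inequality.
  set w : Fin k → ℝ := fun i => √(v i) / √V
  have hw0 : ∀ i, 0 ≤ w i := fun i => by positivity
  have hw : ∑ i, w i ^ 2 ≤ 1 := by
    simp only [w, div_pow, Real.sq_sqrt hV0, Real.sq_sqrt (hv0 _)]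
    rw [← Finset.sum_div]
    exact div_self_le_one V
  have hwv : ∑ i, w i * √(v i) = √V := by
    simp only [w, div_mul_eq_mul_div, Real.mul_self_sqrt (hv0 _)]
    rw [← Finset.sum_div]
    exact Real.div_sqrt
  calc _ ≤ ENNReal.ofReal (r * c * √(2 / Real.pi) * √V) := by gcongr
    _ = ∑ i, ENNReal.ofReal (r * c * w i) * ENNReal.ofReal (√(v i) * √(2 / Real.pi)) := by
      rw [← hwv, Finset.mul_sum, ENNReal.ofReal_sum_of_nonneg fun i _ => by positivity]
      refine Finset.sum_congr rfl fun i _ => ?_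
      rw [← ENNReal.ofReal_mul (by positivity)]
      ring_nf
    _ ≤ ∑ i, ENNReal.ofReal (r * c * w i) * ∫⁻ θ, ENNReal.ofReal |⟪θ, b i⟫| ∂κ := by
      gcongr with i
      have h1 := ofReal_sqrt_le_lintegral_abs_gaussianReal ⟪m, b i⟫ (v i).toNNReal
      rw [← h.map_inner (b i) (hv0 i), lintegral_map (by fun_prop) (by fun_prop),
        Real.coe_toNNReal _ (hv0 i)] at h1
      exact h1
    _ = ∫⁻ θ, ENNReal.ofReal (r * c * ∑ i, w i * |⟪θ, b i⟫|) ∂κ := by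
      have hbm : ∀ i, Measurable fun θ : EuclideanSpace ℝ (Fin d) =>
        ENNReal.ofReal |⟪θ, b i⟫| := fun i => by fun_prop
      simp_rw [← fun i => lintegral_const_mul (μ := κ) (ENNReal.ofReal (r * c * w i)) (hbm i)]
      rw [← lintegral_finsetSum _ fun i _ => by fun_prop]
      refine lintegral_congr fun θ => ?_
      rw [Finset.mul_sum, ENNReal.ofReal_sum_of_nonneg fun i _ =>
        mul_nonneg (by positivity) (mul_nonneg (hw0 i) (abs_nonneg _))]
      refine Finset.sum_congr rfl fun i _ => ?_
      rw [← mul_assoc, ENNReal.ofReal_mul (mul_nonneg (by positivity) (hw0 i))]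
    _ ≤ _ := by
      refine lintegral_mono fun θ => ENNReal.ofReal_le_ofReal ?_
      exact le_regret_of_inner_eq_zero hb (fun i => (hbK i).2) hr
        (mem_closedBall_zero_iff.1 a.2) hw c θ

theorem map_fst_jointLaw (S₀ : Matrix (Fin d) (Fin d) ℝ) (σ : ℝ≥0) (p : Policy d r) (t : ℕ) :
    (jointLaw S₀ σ p t).map Prod.fst = multivariateGaussian 0 S₀ := by
  induction t with
  | zero =>
    rw [jointLaw, Measure.map_map (by fun_prop) (by fun_prop)]
    exact Measure.map_id
  | succ t ih =>
    have := p.markov t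
    rw [← ih]
    refine Measure.ext_of_lintegral _ fun f hf => ?_
    rw [lintegral_map hf measurable_fst, lintegral_map hf measurable_fst,
      lintegral_jointLaw_succ S₀ σ p t (F := fun x => f x.1) (by fun_prop)]
    simp [playRound]

/-- Nonnegativity of the variance of `‖θ‖` gives `(E‖θ‖)² ≤ E‖θ‖²`, and the latter is the sum of the
coordinate variances. -/
theorem integral_norm_multivariateGaussian_le {S₀ : Matrix (Fin d) (Fin d) ℝ}
    (hS₀ : S₀.PosSemidef) : ∫ θ, ‖θ‖ ∂(multivariateGaussian 0 S₀) ≤ √S₀.trace := by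
  refine Real.le_sqrt_of_sq_le ?_
  have hL : MemLp (fun θ : EuclideanSpace ℝ (Fin d) => θ) 2 (multivariateGaussian 0 S₀) :=
    IsGaussian.memLp_two_id
  have h1 := variance_nonneg (fun θ : EuclideanSpace ℝ (Fin d) => ‖θ‖) (multivariateGaussian 0 S₀)
  rw [variance_eq_sub hL.norm] at h1
  have hLi : ∀ i, MemLp (fun θ : EuclideanSpace ℝ (Fin d) => θ i) 2 (multivariateGaussian 0 S₀) :=
    fun i => hL.continuousLinearMap_comp (EuclideanSpace.proj (𝕜 := ℝ) i)
  have h2 : ∫ θ, ‖θ‖ ^ 2 ∂(multivariateGaussian 0 S₀) = S₀.trace := by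
    simp_rw [EuclideanSpace.real_norm_sq_eq]
    rw [integral_finsetSum _ fun i _ => (hLi i).integrable_sq]
    refine Finset.sum_congr rfl fun i _ => ?_
    have h0 : ∫ θ, θ i ∂(multivariateGaussian 0 S₀) = 0 := by
      have h := (EuclideanSpace.proj i : EuclideanSpace ℝ (Fin d) →L[ℝ] ℝ).integral_comp_comm
        (hL.integrable one_le_two)
      simpa using h
    rw [← variance_of_integral_eq_zero (hLi i).aemeasurable h0,
      variance_eval_multivariateGaussian hS₀]
    rfl
  simp only [Pi.pow_apply, h2] at h1
  linarith

theorem trace_eq_sum_of_roots_charpoly {S₀ : Matrix (Fin d) (Fin d) ℝ} (hS₀ : S₀.PosSemidef)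
    {τ : Fin d → ℝ} (hroots : S₀.charpoly.roots = Finset.univ.val.map τ) :
    S₀.trace = ∑ j, τ j := by
  rw [Matrix.trace_eq_sum_roots_charpoly_of_splits hS₀.isHermitian.splits_charpoly, hroots]
  rfl

variable {S₀ : Matrix (Fin d) (Fin d) ℝ}

theorem integrable_norm_jointLaw (S₀ : Matrix (Fin d) (Fin d) ℝ) (σ : ℝ≥0) (p : Policy d r)
    (t : ℕ) : Integrable (fun x => ‖x.1‖) (jointLaw S₀ σ p t) := by
  have h : Integrable (fun θ => ‖θ‖) ((jointLaw S₀ σ p t).map Prod.fst) := by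
    rw [map_fst_jointLaw]
    exact (IsGaussian.integrable_id (μ := multivariateGaussian 0 S₀)).norm
  exact h.comp_measurable measurable_fst

theorem integral_norm_jointLaw_le (hS₀ : S₀.PosSemidef) (σ : ℝ≥0) (p : Policy d r)
    (t : ℕ) : ∫ x, ‖x.1‖ ∂(jointLaw S₀ σ p t) ≤ √S₀.trace := by
  refine le_of_eq_of_le ?_ (integral_norm_multivariateGaussian_le hS₀)
  rw [← map_fst_jointLaw S₀ σ p t, integral_map (by fun_prop) (by fun_prop)]

/-- The joint law of `((θ, H_t), A_t)`. -/
noncomputable def actionLaw (S₀ : Matrix (Fin d) (Fin d) ℝ) (σ : ℝ≥0) (p : Policy d r) (t : ℕ) :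
    Measure ((EuclideanSpace ℝ (Fin d) × History d r t) × Action d r) :=
  jointLaw S₀ σ p t ⊗ₘ (p.kernel t).prodMkLeft (EuclideanSpace ℝ (Fin d))

instance isProbabilityMeasure_actionLaw (S₀ : Matrix (Fin d) (Fin d) ℝ) (σ : ℝ≥0)
    (p : Policy d r) (t : ℕ) : IsProbabilityMeasure (actionLaw S₀ σ p t) := by
  have := p.markov t
  unfold actionLaw
  infer_instance

theorem map_fst_actionLaw (S₀ : Matrix (Fin d) (Fin d) ℝ) (σ : ℝ≥0) (p : Policy d r) (t : ℕ) :
    (actionLaw S₀ σ p t).map Prod.fst = jointLaw S₀ σ p t := by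
  have := p.markov t
  exact Measure.fst_compProd _ _

theorem integrable_norm_actionLaw (S₀ : Matrix (Fin d) (Fin d) ℝ) (σ : ℝ≥0) (p : Policy d r)
    (t : ℕ) : Integrable (fun x => ‖x.1.1‖) (actionLaw S₀ σ p t) := by
  have h := integrable_norm_jointLaw S₀ σ p t
  rw [← map_fst_actionLaw S₀ σ p t] at h
  exact h.comp_measurable measurable_fst

theorem measurable_inner_action {X : Type*} [MeasurableSpace X] :
    Measurable fun x : (EuclideanSpace ℝ (Fin d) × X) × Action d r =>
      ⟪x.1.1, (x.2 : EuclideanSpace ℝ (Fin d))⟫ :=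
  (measurable_fst.comp measurable_fst).inner (measurable_subtype_coe.comp measurable_snd)

theorem integrable_inner_actionLaw (S₀ : Matrix (Fin d) (Fin d) ℝ) (σ : ℝ≥0)
    (p : Policy d r) (t : ℕ) :
    Integrable (fun x => ⟪x.1.1, (x.2 : EuclideanSpace ℝ (Fin d))⟫) (actionLaw S₀ σ p t) := by
  refine ((integrable_norm_actionLaw S₀ σ p t).const_mul r).mono'
    measurable_inner_action.aestronglyMeasurable (Filter.Eventually.of_forall fun x => ?_)
  rw [mul_comm]
  exact (norm_inner_le_norm _ _).trans (mul_le_mul_of_nonneg_left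
    (mem_closedBall_zero_iff.1 x.2.2) (norm_nonneg _))

variable {aStar : EuclideanSpace ℝ (Fin d) → Action d r}

theorem instantRegret_eq (haStar : IsOptimalAction aStar) (hr : 0 ≤ r) (t : ℕ) :
    instantRegret aStar t = fun x => r * ‖x.1‖ - (x.2 (Fin.last t)).2 := by
  funext x
  rw [instantRegret, haStar.inner_eq hr]

theorem integrable_instantRegret_and_integral_eq (haStar : IsOptimalAction aStar) (hr : 0 ≤ r)
    (S₀ : Matrix (Fin d) (Fin d) ℝ) (σ : ℝ≥0) (p : Policy d r) (t : ℕ) :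
    Integrable (instantRegret aStar t) (jointLaw S₀ σ p (t + 1)) ∧
    ∫ x, instantRegret aStar t x ∂(jointLaw S₀ σ p (t + 1)) =
      ∫ x, (r * ‖x.1.1‖ - ⟪x.1.1, (x.2 : EuclideanSpace ℝ (Fin d))⟫) ∂(actionLaw S₀ σ p t) := by
  have hlaw : jointLaw S₀ σ p (t + 1) =
      ((actionLaw S₀ σ p t).prod (gaussianReal 0 (σ ^ 2))).map (playRound t) := rfl
  have hmeas : Measurable (instantRegret aStar t) := by
    rw [instantRegret_eq haStar hr]
    fun_prop
  have hcomp : ∀ z, instantRegret aStar t (playRound t z) =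
      (r * ‖z.1.1.1‖ - ⟪z.1.1.1, (z.1.2 : EuclideanSpace ℝ (Fin d))⟫) - z.2 := fun z => by
    rw [instantRegret_eq haStar hr]
    simp only [playRound, Fin.snoc_last]
    ring
  have hD := ((integrable_norm_actionLaw S₀ σ p t).const_mul r).sub
    (integrable_inner_actionLaw S₀ σ p t)
  have hD' := hD.comp_fst (gaussianReal 0 (σ ^ 2))
  have hW : Integrable (fun w : ℝ => w) (gaussianReal 0 (σ ^ 2)) :=
    IsGaussian.integrable_id
  have hW' := hW.comp_snd (actionLaw S₀ σ p t)
  constructor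
  · rw [hlaw, integrable_map_measure hmeas.aestronglyMeasurable
      (measurable_playRound t).aemeasurable]
    refine (hD'.sub hW').congr (Filter.Eventually.of_forall fun z => ?_)
    exact (hcomp z).symm
  · rw [hlaw, integral_map (measurable_playRound t).aemeasurable hmeas.aestronglyMeasurable]
    simp_rw [hcomp]
    have h1 := integral_sub hD' hW'
    rw [integral_fun_snd (μ := actionLaw S₀ σ p t) (fun w : ℝ => w), integral_id_gaussianReal,
      smul_zero, sub_zero] at h1
    refine h1.trans ?_
    rw [integral_fun_fst (ν := gaussianReal 0 (σ ^ 2)), probReal_univ, one_smul]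
    rfl

/-- The posterior bound is uniform in history and action, so it survives averaging. Since `c` is a
constant, the penalty involves `‖θ‖` only through its prior mean, and no posterior norm needs
control. -/
theorem le_integral_regret (hS₀ : S₀.PosSemidef)
    {τ : Fin d → ℝ} (hτ0 : ∀ j, 0 ≤ τ j) (hτ : Antitone τ)
    (hroots : S₀.charpoly.roots = Finset.univ.val.map τ) (hr : 0 ≤ r) (σ : ℝ≥0)
    (p : Policy d r) (t : ℕ) {c : ℝ} (hc : 0 ≤ c) :
    r * c * √(2 / Real.pi) *
        √(∑ j ∈ Finset.univ.filter (fun j : Fin d => t + 1 ≤ (j : ℕ)), τ j) ≤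
      ∫ x, (r * ‖x.1.1‖ - ⟪x.1.1, (x.2 : EuclideanSpace ℝ (Fin d))⟫) ∂(actionLaw S₀ σ p t) +
        r * (c ^ 2 / 2) * √(∑ j, τ j) := by
  have := p.markov t
  obtain ⟨κ, m, C, _, hκ⟩ := exists_isPosterior hS₀ σ p t
  set f : (EuclideanSpace ℝ (Fin d) × History d r t) × Action d r → ℝ := fun x =>
    (r * ‖x.1.1‖ - ⟪x.1.1, (x.2 : EuclideanSpace ℝ (Fin d))⟫) + r * (c ^ 2 / 2) * ‖x.1.1‖
  have hD := ((integrable_norm_actionLaw S₀ σ p t).const_mul r).sub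
    (integrable_inner_actionLaw S₀ σ p t)
  have hN := (integrable_norm_actionLaw S₀ σ p t).const_mul (r * (c ^ 2 / 2))
  have hfint : Integrable f (actionLaw S₀ σ p t) := hD.add hN
  have hf0 : ∀ x, 0 ≤ f x := fun x => by
    have h1 : ⟪x.1.1, (x.2 : EuclideanSpace ℝ (Fin d))⟫ ≤ r * ‖x.1.1‖ := by
      rw [mul_comm]
      exact (real_inner_le_norm _ _).trans (mul_le_mul_of_nonneg_left
        (mem_closedBall_zero_iff.1 x.2.2) (norm_nonneg _))
    have h2 : 0 ≤ r * (c ^ 2 / 2) * ‖x.1.1‖ := by positivity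
    simp only [f]
    linarith
  have hfi : ∫ x, f x ∂(actionLaw S₀ σ p t) =
      ∫ x, (r * ‖x.1.1‖ - ⟪x.1.1, (x.2 : EuclideanSpace ℝ (Fin d))⟫) ∂(actionLaw S₀ σ p t) +
        r * (c ^ 2 / 2) * ∫ x, ‖x.1‖ ∂(jointLaw S₀ σ p t) := by
    rw [← map_fst_actionLaw S₀ σ p t, integral_map (by fun_prop) (by fun_prop),
      ← integral_const_mul]
    exact integral_add hD hN
  have hfm : Measurable fun x => ENNReal.ofReal (f x) := by
    have := measurable_inner_action (d := d) (r := r) (X := History d r t)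
    fun_prop
  have hle : ENNReal.ofReal (r * c * √(2 / Real.pi) *
        √(∑ j ∈ Finset.univ.filter (fun j : Fin d => t + 1 ≤ (j : ℕ)), τ j)) ≤
      ENNReal.ofReal (∫ x, f x ∂(actionLaw S₀ σ p t)) := by
    rw [ofReal_integral_eq_lintegral_ofReal hfint (Filter.Eventually.of_forall hf0),
      actionLaw, Measure.lintegral_compProd hfm, hκ.resample _ (hfm.lintegral_kernel_prod_right'
        (κ := (p.kernel t).prodMkLeft (EuclideanSpace ℝ (Fin d))))]
    simp only [Kernel.prodMkLeft_apply]
    rw [← one_mul (ENNReal.ofReal _), ← measure_univ (μ := jointLaw S₀ σ p t), mul_comm,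
      ← lintegral_const]
    refine lintegral_mono fun x => ?_
    rw [lintegral_lintegral_swap (μ := κ x.2) (ν := p.kernel t x.2)]
    · rw [← one_mul (ENNReal.ofReal _), ← measure_univ (μ := p.kernel t x.2), mul_comm,
        ← lintegral_const]
      refine lintegral_mono fun a => ?_
      obtain ⟨K, hK, hKC⟩ := hκ.exists_subspace x.2
      exact ofReal_le_lintegral_regret hS₀ hτ0 hτ hroots (hκ.isGaussian x.2) (hκ.nonneg x.2) hK
        hKC hr a hc
    · have : Measurable fun z : EuclideanSpace ℝ (Fin d) × Action d r => ((z.1, x.2), z.2) := by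
        fun_prop
      exact (hfm.comp this).aemeasurable
  rw [ENNReal.ofReal_le_ofReal_iff (integral_nonneg hf0), hfi] at hle
  refine hle.trans (add_le_add_right (mul_le_mul_of_nonneg_left ?_ (by positivity)) _)
  rw [← trace_eq_sum_of_roots_charpoly hS₀ hroots]
  exact integral_norm_jointLaw_le hS₀ σ p t

/-- The expected regret in one round. -/
theorem div_le_integral_regret (hS₀ : S₀.PosSemidef)
    {τ : Fin d → ℝ} (hτ0 : ∀ j, 0 ≤ τ j) (hτ : Antitone τ)
    (hroots : S₀.charpoly.roots = Finset.univ.val.map τ) (hr : 0 ≤ r) (σ : ℝ≥0)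
    (p : Policy d r) (t : ℕ) :
    r / (Real.pi * √(∑ j, τ j)) *
        ∑ j ∈ Finset.univ.filter (fun j : Fin d => t + 1 ≤ (j : ℕ)), τ j ≤
      ∫ x, (r * ‖x.1.1‖ - ⟪x.1.1, (x.2 : EuclideanSpace ℝ (Fin d))⟫) ∂(actionLaw S₀ σ p t) := by
  set L := ∑ j ∈ Finset.univ.filter (fun j : Fin d => t + 1 ≤ (j : ℕ)), τ j
  have hL0 : 0 ≤ L := Finset.sum_nonneg fun j _ => hτ0 j
  set N := √(∑ j, τ j)
  have h := le_integral_regret hS₀ hτ0 hτ hroots hr σ p t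
    -- For `N > 0` this maximizes `c √(2/π) √L - c² N / 2`, with value `L / (π N)`. For `N = 0`
    -- division by zero makes the bound `0`.
    (c := √(2 / Real.pi) * √L / N) (by positivity)
  refine le_trans (le_of_eq ?_) (sub_le_iff_le_add.2 h)
  have hpi : √(2 / Real.pi) ^ 2 = 2 / Real.pi := Real.sq_sqrt (by positivity)
  have hLs : √L ^ 2 = L := Real.sq_sqrt hL0
  rcases eq_or_ne N 0 with hN | hN
  · simp [hN]
  · have : r * (√(2 / Real.pi) * √L / N) * √(2 / Real.pi) * √L =
        r * (√(2 / Real.pi) ^ 2 * √L ^ 2) / N := by ring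
    rw [this, div_pow, mul_pow, hpi, hLs]
    field_simp
    ring

/-- After swapping the sums, a zero-based index `j < T` is counted once for each `t < j`, that is
`j` times. The nonnegative terms with `j ≥ T` are discarded. -/
theorem sum_le_sum_range_sum {τ : Fin d → ℝ} (hτ0 : ∀ j, 0 ≤ τ j) (T : ℕ) :
    ∑ j ∈ Finset.univ.filter (fun j : Fin d => (j : ℕ) + 1 ∈ Finset.Icc 2 (min T d)),
          (((j : ℕ) + 1 : ℝ) - 1) * τ j ≤
      ∑ t ∈ Finset.range T, ∑ j ∈ Finset.univ.filter (fun j : Fin d => t + 1 ≤ (j : ℕ)), τ j := by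
  simp_rw [Finset.sum_filter]
  rw [Finset.sum_comm]
  refine Finset.sum_le_sum fun j _ => ?_
  rw [← Finset.sum_filter, Finset.sum_const, nsmul_eq_mul, add_sub_cancel_right]
  split_ifs with h
  · refine mul_le_mul_of_nonneg_right ?_ (hτ0 j)
    rw [Finset.mem_Icc, le_min_iff] at h
    have : Finset.range (j : ℕ) ⊆ (Finset.range T).filter (fun t => t + 1 ≤ (j : ℕ)) := by
      intro t ht
      simp only [Finset.mem_range, Finset.mem_filter] at ht ⊢
      omega
    exact_mod_cast (Finset.card_range (j : ℕ)).symm.trans_le (Finset.card_le_card this)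
  · exact mul_nonneg (Nat.cast_nonneg _) (hτ0 j)

end Regret

end LinearGaussianBandit

/-- The eigenvalues of `S₀`, with multiplicity and in decreasing order, are `τ_1², …, τ_d²`, where
`τ_i` is `τ j` for `i = j + 1`. -/
theorem mainTheorem4 (d : ℕ) (r : ℝ) (hr : 0 ≤ r) (σ : ℝ≥0)
    (S₀ : Matrix (Fin d) (Fin d) ℝ) (hS₀ : S₀.PosSemidef)
    (τ : EuclideanSpace ℝ (Fin d)) (hτ_anti : Antitone fun j => τ j ^ 2)
    (hτ_eig : S₀.charpoly.roots = Finset.univ.val.map fun j => τ j ^ 2)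
    (aStar : EuclideanSpace ℝ (Fin d) → Action d r) (haStar : IsOptimalAction aStar)
    (p : Policy d r) (T : ℕ) :
    (∀ t < T, Integrable (instantRegret aStar t) (jointLaw S₀ σ p (t + 1))) ∧
    r / (Real.pi * ‖τ‖) *
        ∑ j ∈ Finset.univ.filter (fun j : Fin d => (j : ℕ) + 1 ∈ Finset.Icc 2 (min T d)),
          (((j : ℕ) + 1 : ℝ) - 1) * τ j ^ 2
      ≤ bayesRegret S₀ σ aStar p T := by
  have h := integrable_instantRegret_and_integral_eq haStar hr S₀ σ p
  refine ⟨fun t _ => (h t).1, ?_⟩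
  have hnorm : ‖τ‖ = √(∑ j, τ j ^ 2) := by
    rw [EuclideanSpace.norm_eq]
    simp
  have hτ0 : ∀ j, 0 ≤ τ j ^ 2 := fun j => sq_nonneg _
  refine (mul_le_mul_of_nonneg_left (sum_le_sum_range_sum hτ0 T) (by positivity)).trans ?_
  rw [Finset.mul_sum, bayesRegret, hnorm]
  refine Finset.sum_le_sum fun t _ => ?_
  rw [(h t).2]
  exact div_le_integral_regret hS₀ hτ0 hτ_anti hτ_eig hr σ p t
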